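/- Let $\{B_v\}_{v\in V}$ be an infinite family of pairwise disjoint open disks of diameter $1$ in the Euclidean plane $\mathbb R^2$, with centers $c_v$. Its penny graph is the (locally finite, simple) graph on $V$ in which $v\sim w$ if and only if the boundary circles of $B_v$ and $B_w$ are tangent, i.e. $|c_v-c_w|=1$. It is embedded in the plane by drawing each vertex $v$ at $c_v$ and each edge as the straight segment joining the two centers. The faces are the connected components of the complement of the embedded graph. The facial degree $\deg(\sigma)\in\mathbb N\cup\{\infty\}$ of a face $\sigma$ is its number of corners (interior angles, those of size at least $\pi$ included): for each vertex $v$, the edges at $v$ cut the disk $B_v$ into sectors, and the corners of $\sigma$ at $v$ are the sectors contained in $\sigma$. Assume that the penny graph is connected and has bounded facial degree, that is, $\sup_\sigma\deg(\sigma)<\infty$. Then: 1. The simple random walk on the graph (which at each step moves to a uniformly chosen neighbor) is recurrent: started at any vertex, it almost surely returns to that vertex at some time $n\ge 1$. 2. Every positive superharmonic function is constant: if $f:V\to(0,\infty)$ satisfies $\Delta f(x):=\sum_{y\sim x}(f(y)-f(x))\le 0$ for all $x\in V$, then $f$ is constant. -/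

import Mathlib

/-- The Euclidean plane. -/
abbrev Plane : Type := EuclideanSpace ℝ (Fin 2)

/-- A collection of non-overlapping pennies indexed by `V`: open disks of diameter `1` in the plane,
given by their centers, which are pairwise disjoint. -/
structure PennyConfiguration (V : Type*) where
  center : V → Plane
  disjoint_pennies : ∀ i j, i ≠ j →
    Disjoint (Metric.ball (center i) (1 / 2)) (Metric.ball (center j) (1 / 2))

namespace PennyConfiguration

variable {V : Type*} (P : PennyConfiguration V)

/-- The open disk represented by the vertex `v`. -/
def penny (v : V) : Set Plane := Metric.ball (P.center v) (1 / 2)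

/-- The contact graph. Two distinct non-overlapping circles of radius `1 / 2` are tangent to each
other iff their centers are at distance `1`. -/
def graph : SimpleGraph V where
  Adj i j := dist (P.center i) (P.center j) = 1
  symm := ⟨fun i j h => by rw [dist_comm]; exact h⟩
  loopless := ⟨fun i h => by simp at h⟩

theorem one_le_dist {i j : V} (h : i ≠ j) : 1 ≤ dist (P.center i) (P.center j) := by
  have := (disjoint_ball_ball_iff (by norm_num) (by norm_num)).1 (P.disjoint_pennies i j h)
  linarith

theorem finite_neighborSet (v : V) : (P.graph.neighborSet v).Finite := by
  obtain ⟨t, -, ht, hcov⟩ := (isCompact_closedBall (P.center v) 1).finite_cover_balls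
    (e := (1 / 2 : ℝ)) (by norm_num)
  have key : ∀ w : V, w ∈ P.graph.neighborSet v →
      ∃ c ∈ t, dist (P.center w) c < 1 / 2 := by
    intro w hw
    have hw' : dist (P.center v) (P.center w) = 1 := hw
    have : P.center w ∈ Metric.closedBall (P.center v) 1 := by
      rw [Metric.mem_closedBall, dist_comm, hw']
    simpa using hcov this
  choose! g hg hgd using key
  refine Set.Finite.of_finite_image (f := g) (ht.subset ?_) ?_
  · rintro _ ⟨w, hw, rfl⟩
    exact hg w hw
  · intro w hw w' hw' h
    by_contra hne
    have h1 := P.one_le_dist hne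
    have h2 := hgd w hw
    have h3 := hgd w' hw'
    rw [← h] at h3
    have h4 := dist_triangle_right (P.center w) (P.center w') (g w)
    linarith

/-- The contact graph is locally finite. -/
noncomputable instance instLocallyFiniteGraph : P.graph.LocallyFinite :=
  fun v => (P.finite_neighborSet v).fintype

/-- The image of the geometric embedding of the contact graph in the plane: the centers of the
pennies together with the segments joining the centers of tangent pennies. -/
def embeddingImage : Set Plane :=
  Set.range P.center ∪
    ⋃ (i : V) (j : V) (_ : P.graph.Adj i j), segment ℝ (P.center i) (P.center j)

/-- The faces: the connected components of the complement of the embedding image. -/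
def faces : Set (Set Plane) :=
  {σ | ∃ z ∈ P.embeddingImageᶜ, σ = connectedComponentIn P.embeddingImageᶜ z}

/-- The corners (interior angles) of `σ`. The edges at `v` cut the penny of `v` into
circular sectors (no other edge or vertex meets this penny), which are the connected components of
the penny minus the embedding image; a corner of `σ` at `v` is a sector of `v` lying in `σ`. A
vertex that the boundary of `σ` visits several times thus has several corners in `σ`, and interior
angles equal to or larger than `π` count as corners too. -/
def corners (σ : Set Plane) : Set (V × Set Plane) :=
  {c | (∃ z ∈ P.penny c.1 \ P.embeddingImage,
    c.2 = connectedComponentIn (P.penny c.1 \ P.embeddingImage) z) ∧ c.2 ⊆ σ}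

/-- The facial degree: the number of corners, possibly infinite. -/
noncomputable def facialDegree (σ : Set Plane) : ℕ∞ := (P.corners σ).encard

/-- The facial degrees are bounded by a finite number. -/
def HasBoundedFacialDegree : Prop := ∃ D : ℕ, ∀ σ ∈ P.faces, P.facialDegree σ ≤ D

end PennyConfiguration

namespace SimpleGraph

open MeasureTheory ProbabilityTheory

variable {V : Type*} (G : SimpleGraph V) [G.LocallyFinite]

/-- The combinatorial Laplacian. -/
noncomputable def combLaplacian (f : V → ℝ) (x : V) : ℝ :=
  ∑ y ∈ G.neighborFinset x, (f y - f x)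

/-- Superharmonic functions. -/
def IsSuperharmonic (f : V → ℝ) : Prop := ∀ x, G.combLaplacian f x ≤ 0

open Classical in
/-- One step of the simple random walk from `x`: a uniformly chosen neighbor of `x`. (At a vertex
without neighbors the walk stays; a connected graph with two or more vertices has none.) -/
noncomputable def walkStep (x : V) : PMF V :=
  if h : (G.neighborFinset x).Nonempty then PMF.uniformOfFinset (G.neighborFinset x) h
  else PMF.pure x

section Walk

variable [MeasurableSpace V] [DiscreteMeasurableSpace V]

/-- The law of the position at time `n + 1` given the positions up to time `n`. -/
noncomputable def walkKernel (n : ℕ) : Kernel (Π _ : Finset.Iic n, V) V where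
  toFun h := (G.walkStep (h ⟨n, Finset.mem_Iic.2 le_rfl⟩)).toMeasure
  measurable' :=
    (Measurable.of_discrete (f := fun x => (G.walkStep x).toMeasure)).comp (measurable_pi_apply _)

instance instIsMarkovKernelWalkKernel (n : ℕ) : IsMarkovKernel (G.walkKernel n) :=
  ⟨fun h => PMF.toMeasure.isProbabilityMeasure
    (G.walkStep (h ⟨n, Finset.mem_Iic.2 le_rfl⟩))⟩

/-- The law, on the space of trajectories `ℕ → V`, of the simple random walk started at `x`. -/
noncomputable def walkLaw (x : V) : Measure (ℕ → V) :=
  Kernel.traj (X := fun _ => V) (fun n => G.walkKernel n) 0 (fun _ => x)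

end Walk

/-- The simple random walk is recurrent: from every vertex, it almost surely returns there. -/
def IsRecurrent : Prop :=
  letI : MeasurableSpace V := ⊤
  haveI : DiscreteMeasurableSpace V := ⟨fun _ => trivial⟩
  ∀ x : V, ∀ᵐ ω ∂(G.walkLaw x), ∃ n : ℕ, 1 ≤ n ∧ ω n = x

end SimpleGraph

/-! The plane has quadratic area growth, and this makes the graph parabolic. Disjoint pennies occupy
area, so `O(r ^ 2)` centers lie within distance `r` of the origin, and degrees are bounded. A
logarithmic cutoff at scale `2 ^ n` varies by `O(1 / (n r))` along an edge at radius `r`; each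
dyadic annulus then contributes energy `O(1 / n ^ 2)`, and the total is `O(1 / n)`
(`dirichletEnergy_cutoff_le`).

For a positive superharmonic `f`, the ground state transform bounds the energy of `φ` below by the
sum of `f x * f y * (φ x / f x - φ y / f y) ^ 2` over edges. Letting `φ` tend to `1` with vanishing
energy forces `1 / f` to agree across every edge.

Recurrence follows: the probability of never visiting `o` at a positive time, reset to `0` at `o`,
is bounded and subharmonic. Two minus it is positive superharmonic, hence constant, so the escape
probability vanishes. -/

namespace SimpleGraph

/-! ### Energy and the Liouville property -/

section Parabolic

open Filter Topology

variable {V : Type*} (G : SimpleGraph V)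

open Classical in
/-- The Dirichlet energy of `φ` on the part of the graph with vertices in the finite set `T`
(every edge counts twice). -/
noncomputable def dirichletEnergy (T : Finset V) (φ : V → ℝ) : ℝ :=
  ∑ x ∈ T, ∑ y ∈ T, if G.Adj x y then (φ x - φ y) ^ 2 else 0

/-- Pointwise form of the ground state transform. -/
theorem sub_mul_sq_div_sub_eq {a b s t : ℝ} (ha : 0 < a) (hb : 0 < b) :
    (a - b) * (s ^ 2 / a - t ^ 2 / b) = (s - t) ^ 2 - a * b * (s / a - t / b) ^ 2 := by
  field_simp
  ring

variable {G}

open Classical in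
theorem sum_finset_adj_eq [G.LocallyFinite] {T : Finset V} {x : V}
    (h : ∀ y, G.Adj x y → y ∈ T) (a : V → ℝ) :
    ∑ y ∈ T, (if G.Adj x y then a y else 0) = ∑ y ∈ G.neighborFinset x, a y := by
  rw [← Finset.sum_filter]
  congr 1
  ext y
  simp only [Finset.mem_filter, mem_neighborFinset, and_iff_right_iff_imp]
  exact h y

open Classical in
/-- Summation by parts: a positive superharmonic function controls the energy of a finitely
supported function from below. -/
theorem IsSuperharmonic.sum_le_dirichletEnergy [G.LocallyFinite] {f : V → ℝ}
    (hf : G.IsSuperharmonic f) (hpos : ∀ x, 0 < f x) {φ : V → ℝ} {S T : Finset V}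
    (hφ : ∀ x, x ∉ S → φ x = 0) (hT : ∀ x ∈ S, ∀ y, G.Adj x y → y ∈ T) :
    ∑ x ∈ T, ∑ y ∈ T, (if G.Adj x y then f x * f y * (φ x / f x - φ y / f y) ^ 2 else 0) ≤
      G.dirichletEnergy T φ := by
  -- Test superharmonicity against `φ ^ 2 / f`, the choice for which the ground state identity
  -- applies.
  set g : V → ℝ := fun x => φ x ^ 2 / f x with hg
  have hnn : 0 ≤ ∑ x ∈ T, ∑ y ∈ T, if G.Adj x y then (f x - f y) * g x else 0 := by
    refine Finset.sum_nonneg fun x _ => ?_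
    by_cases hx : x ∈ S
    · rw [sum_finset_adj_eq (hT x hx), ← Finset.sum_mul]
      refine mul_nonneg ?_ (div_nonneg (sq_nonneg _) (hpos x).le)
      have := hf x
      simp only [combLaplacian, Finset.sum_sub_distrib] at this ⊢
      linarith
    · simp [hg, hφ x hx]
  have hswap : ∑ x ∈ T, ∑ y ∈ T, (if G.Adj x y then (f x - f y) * g x else 0) =
      ∑ x ∈ T, ∑ y ∈ T, if G.Adj x y then (f y - f x) * g y else 0 := by
    rw [Finset.sum_comm]
    simp only [G.adj_comm]
  have hsum : ∑ x ∈ T, ∑ y ∈ T, (if G.Adj x y then (f x - f y) * (g x - g y) else 0) =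
      (∑ x ∈ T, ∑ y ∈ T, if G.Adj x y then (f x - f y) * g x else 0) +
      ∑ x ∈ T, ∑ y ∈ T, if G.Adj x y then (f y - f x) * g y else 0 := by
    simp only [← Finset.sum_add_distrib]
    refine Finset.sum_congr rfl fun x _ => Finset.sum_congr rfl fun y _ => ?_
    split_ifs <;> ring
  have hid : ∑ x ∈ T, ∑ y ∈ T, (if G.Adj x y then (f x - f y) * (g x - g y) else 0) =
      G.dirichletEnergy T φ -
      ∑ x ∈ T, ∑ y ∈ T,
        (if G.Adj x y then f x * f y * (φ x / f x - φ y / f y) ^ 2 else 0) := by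
    simp only [dirichletEnergy, ← Finset.sum_sub_distrib]
    refine Finset.sum_congr rfl fun x _ => Finset.sum_congr rfl fun y _ => ?_
    split_ifs
    · exact sub_mul_sq_div_sub_eq (hpos x) (hpos y)
    · ring
  linarith

/-- If there are finitely supported functions that tend to `1` and whose energies tend to `0`, then
every positive superharmonic function is constant. -/
theorem IsSuperharmonic.eq_of_tendsto_energy [G.LocallyFinite] (hconn : G.Connected)
    {φ : ℕ → V → ℝ} (hfin : ∀ n, (Function.support (φ n)).Finite)
    (hlim : ∀ x, Tendsto (fun n => φ n x) atTop (𝓝 1)) {B : ℕ → ℝ}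
    (hB : Tendsto B atTop (𝓝 0)) (henergy : ∀ n T, G.dirichletEnergy T (φ n) ≤ B n)
    {f : V → ℝ} (hf : G.IsSuperharmonic f) (hpos : ∀ x, 0 < f x) (x y : V) : f x = f y := by
  classical
  have hadj : ∀ x y, G.Adj x y → f x = f y := by
    intro x y hxy
    have hle : ∀ n, f x * f y * (φ n x / f x - φ n y / f y) ^ 2 ≤ B n := by
      intro n
      -- `x` may lie outside the support; inserting it ensures that `T` contains both ends of the
      -- edge.
      set S : Finset V := insert x (hfin n).toFinset with hS
      set T : Finset V := S ∪ S.biUnion fun x => G.neighborFinset x with hTdef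
      have hT : ∀ x ∈ S, ∀ y, G.Adj x y → y ∈ T := fun x hx y hxy =>
        Finset.mem_union_right _ (Finset.mem_biUnion.2 ⟨x, hx, by simpa using hxy⟩)
      have hφ : ∀ x, x ∉ S → φ n x = 0 := fun z hz => by
        by_contra hne
        exact hz (by simp [hS, hne])
      refine le_trans ?_ ((hf.sum_le_dirichletEnergy hpos hφ hT).trans
        (henergy n T))
      have hnn : ∀ a b, 0 ≤ if G.Adj a b then
          f a * f b * (φ n a / f a - φ n b / f b) ^ 2 else 0 := fun a b => by
        have := hpos a
        have := hpos b
        split_ifs <;> positivity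
      have hx : x ∈ S := Finset.mem_insert_self _ _
      calc f x * f y * (φ n x / f x - φ n y / f y) ^ 2
          = if G.Adj x y then f x * f y * (φ n x / f x - φ n y / f y) ^ 2 else 0 := by
            rw [if_pos hxy]
        _ ≤ ∑ y ∈ T, if G.Adj x y then
              f x * f y * (φ n x / f x - φ n y / f y) ^ 2 else 0 :=
            Finset.single_le_sum (f := fun y => if G.Adj x y then
              f x * f y * (φ n x / f x - φ n y / f y) ^ 2 else 0)
              (fun b _ => hnn x b) (hT x hx y hxy)
        _ ≤ _ := Finset.single_le_sum (f := fun x => ∑ y ∈ T, if G.Adj x y then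
              f x * f y * (φ n x / f x - φ n y / f y) ^ 2 else 0)
              (fun a _ => Finset.sum_nonneg fun b _ => hnn a b)
              (Finset.mem_union_left _ hx)
    have hl : Tendsto (fun n => f x * f y * (φ n x / f x - φ n y / f y) ^ 2) atTop
        (𝓝 (f x * f y * (1 / f x - 1 / f y) ^ 2)) :=
      ((((hlim x).div_const _).sub ((hlim y).div_const _)).pow 2).const_mul _
    have h0 := le_of_tendsto_of_tendsto' hl hB hle
    have hx := hpos x
    have hy := hpos y
    have h1 : (1 / f x - 1 / f y) ^ 2 ≤ 0 := nonpos_of_mul_nonpos_right h0 (mul_pos hx hy)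
    have h2 : 1 / f x - 1 / f y = 0 := pow_eq_zero_iff two_ne_zero |>.1 (le_antisymm h1 (sq_nonneg _))
    have h3 : f y - f x = 0 := by
      field_simp at h2
      linarith
    linarith
  obtain ⟨p⟩ := hconn x y
  induction p with
  | nil => rfl
  | cons h _ ih => exact (hadj _ _ h).trans ih

end Parabolic

end SimpleGraph

/-! ### Area growth and logarithmic cutoffs -/

namespace PennyConfiguration

open Filter Topology MeasureTheory

variable {V : Type*} (P : PennyConfiguration V)

/-- Area comparison: the pennies are disjoint and fit in a disk of radius `r + 1 / 2`. -/
theorem card_le_of_dist_le {s : Finset V} {p : Plane} {r : ℝ} (hr : 0 ≤ r)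
    (h : ∀ i ∈ s, dist (P.center i) p ≤ r) : (s.card : ℝ) ≤ (2 * r + 1) ^ 2 := by
  set m := volume (Metric.ball (0 : Plane) 1)
  have hm0 : m ≠ 0 := (Metric.measure_ball_pos volume _ one_pos).ne'
  have hmtop : m ≠ ⊤ := measure_ball_lt_top.ne
  have hball : ∀ (x : Plane) {t : ℝ}, 0 < t →
      volume (Metric.ball x t) = ENNReal.ofReal (t ^ 2) * m := fun x t ht => by
    rw [Measure.addHaar_ball_of_pos volume x ht, finrank_euclideanSpace_fin]
  have hsub : ⋃ i ∈ s, Metric.ball (P.center i) (1 / 2) ⊆ Metric.ball p (r + 1 / 2) := by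
    refine Set.iUnion₂_subset fun i hi => Metric.ball_subset_ball' ?_
    linarith [h i hi]
  have hvol := measure_mono (μ := volume) hsub
  rw [measure_biUnion_finset (fun i _ j _ hij => P.disjoint_pennies i j hij)
    (fun i _ => Metric.isOpen_ball.measurableSet), Finset.sum_congr rfl
    (fun i _ => hball (P.center i) one_half_pos), Finset.sum_const, hball p (by positivity),
    nsmul_eq_mul, ← mul_assoc, ENNReal.mul_le_mul_iff_left hm0 hmtop] at hvol
  rw [← ENNReal.ofReal_natCast, ← ENNReal.ofReal_mul (by positivity),
    ENNReal.ofReal_le_ofReal_iff (by positivity)] at hvol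
  nlinarith

theorem card_neighborFinset_le (x : V) : ((P.graph.neighborFinset x).card : ℝ) ≤ 9 := by
  have := P.card_le_of_dist_le (s := P.graph.neighborFinset x) (p := P.center x) zero_le_one
    fun i hi => by
      have h : dist (P.center x) (P.center i) = 1 := (P.graph.mem_neighborFinset x i).1 hi
      rw [dist_comm, h]
  exact this.trans (by norm_num)

/-- One plus the distance of a center to the origin. -/
noncomputable def radius (x : V) : ℝ := 1 + ‖P.center x‖

/-- The shift by one puts every center in a dyadic annulus of index at least `0` and makes the radii
of adjacent vertices comparable up to a factor `2`. -/
theorem one_le_radius (x : V) : 1 ≤ P.radius x := by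
  unfold radius
  linarith [norm_nonneg (P.center x)]

theorem radius_pos (x : V) : 0 < P.radius x := one_pos.trans_le (P.one_le_radius x)

variable {P} in
theorem abs_radius_sub_le {x y : V} (h : P.graph.Adj x y) : |P.radius x - P.radius y| ≤ 1 := by
  have h1 : dist (P.center x) (P.center y) = 1 := h
  rw [radius, radius, add_sub_add_left_eq_sub, ← h1, dist_eq_norm]
  exact abs_norm_sub_norm_le _ _

theorem card_le_of_radius_le {s : Finset V} {r : ℝ} (hr : 1 ≤ r) (h : ∀ i ∈ s, P.radius i ≤ r) :
    (s.card : ℝ) ≤ 4 * r ^ 2 := by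
  have := P.card_le_of_dist_le (s := s) (p := 0) (r := r - 1) (by linarith) fun i hi => by
    have := h i hi
    rw [radius] at this
    rw [dist_zero_right]
    linarith
  nlinarith

/-- Summation over dyadic annuli. -/
theorem sum_inv_radius_sq_le {s : Finset V} {n : ℕ} (h : ∀ x ∈ s, P.radius x < 2 ^ n) :
    ∑ x ∈ s, (P.radius x ^ 2)⁻¹ ≤ 16 * n := by
  have hfloor : ∀ x, ⌊P.radius x⌋₊ ≠ 0 := fun x =>
    (Nat.floor_pos.2 (P.one_le_radius x)).ne'
  have hlow : ∀ x, (2 : ℝ) ^ Nat.log 2 ⌊P.radius x⌋₊ ≤ P.radius x := fun x => by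
    refine le_trans ?_ (Nat.floor_le (P.radius_pos x).le)
    exact_mod_cast Nat.pow_log_le_self 2 (hfloor x)
  have hup : ∀ x, P.radius x < (2 : ℝ) ^ (Nat.log 2 ⌊P.radius x⌋₊ + 1) := fun x => by
    have := (Nat.floor_lt (P.radius_pos x).le).1 (Nat.lt_pow_succ_log_self one_lt_two ⌊P.radius x⌋₊)
    exact_mod_cast this
  have hmaps : ∀ x ∈ s, Nat.log 2 ⌊P.radius x⌋₊ ∈ Finset.range n := fun x hx => by
    rw [Finset.mem_range]
    exact (pow_lt_pow_iff_right₀ (one_lt_two (α := ℝ))).1 ((hlow x).trans_lt (h x hx))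
  rw [← Finset.sum_fiberwise_of_maps_to hmaps]
  -- The annulus from `2 ^ k` to `2 ^ (k + 1)` has at most `4 * 4 ^ (k + 1)` centers, each of weight
  -- at most `4 ^ (-k)`.
  calc _ ≤ ∑ _k ∈ Finset.range n, (16 : ℝ) := Finset.sum_le_sum fun k _ => ?_
    _ = 16 * n := by simp [mul_comm]
  set t := s.filter fun x => Nat.log 2 ⌊P.radius x⌋₊ = k
  have hcard : (t.card : ℝ) ≤ 4 * (2 ^ (k + 1)) ^ 2 :=
    P.card_le_of_radius_le (one_le_pow₀ one_le_two) fun x hx => by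
      rw [← (Finset.mem_filter.1 hx).2]
      exact (hup x).le
  have hk : (0 : ℝ) < 2 ^ k := by positivity
  calc ∑ x ∈ t, (P.radius x ^ 2)⁻¹ ≤ ∑ _x ∈ t, (((2 : ℝ) ^ k) ^ 2)⁻¹ :=
        Finset.sum_le_sum fun x hx => by
          rw [← (Finset.mem_filter.1 hx).2]
          gcongr
          exact hlow x
    _ = t.card * (((2 : ℝ) ^ k) ^ 2)⁻¹ := by simp
    _ ≤ 4 * (2 ^ (k + 1)) ^ 2 * (((2 : ℝ) ^ k) ^ 2)⁻¹ := by gcongr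
    _ = 16 := by
      field_simp
      ring

/-- The logarithmic cutoff function, which vanishes where the radius is at least `2 ^ n`. -/
noncomputable def cutoff (n : ℕ) (x : V) : ℝ := max 0 (1 - Real.logb 2 (P.radius x) / n)

theorem radius_lt_of_cutoff_ne_zero {n : ℕ} (hn : n ≠ 0) {x : V} (h : P.cutoff n x ≠ 0) :
    P.radius x < 2 ^ n := by
  have hn' : (0 : ℝ) < n := by positivity
  by_contra! hle
  refine h (max_eq_left ?_)
  have h1 : (n : ℝ) ≤ Real.logb 2 (P.radius x) := by
    rw [Real.le_logb_iff_rpow_le one_lt_two (P.radius_pos x)]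
    exact_mod_cast hle
  have := (one_le_div hn').2 h1
  linarith

theorem finite_radius_lt (r : ℝ) : {x | P.radius x < r}.Finite := by
  by_contra hinf
  set r' := max r 1
  obtain ⟨t, hts, htc⟩ := Set.Infinite.exists_subset_card_eq hinf (⌈4 * r' ^ 2⌉₊ + 1)
  have h1 := P.card_le_of_radius_le (s := t) (r := r') (le_max_right _ _) fun i hi =>
    (show P.radius i < r from hts hi).le.trans (le_max_left _ _)
  have h2 := Nat.le_ceil (4 * r' ^ 2)
  rw [htc] at h1
  push_cast at h1
  linarith

theorem finite_support_cutoff {n : ℕ} (hn : n ≠ 0) : (Function.support (P.cutoff n)).Finite :=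
  (P.finite_radius_lt (2 ^ n)).subset fun _ hx => P.radius_lt_of_cutoff_ne_zero hn hx

theorem tendsto_cutoff (x : V) : Tendsto (fun n => P.cutoff n x) atTop (𝓝 1) := by
  have h : Tendsto (fun n : ℕ => max 0 (1 - Real.logb 2 (P.radius x) / n)) atTop
      (𝓝 (max 0 (1 - 0))) :=
    tendsto_const_nhds.max
      (tendsto_const_nhds.sub (tendsto_const_nhds.div_atTop tendsto_natCast_atTop_atTop))
  simpa [cutoff] using h

-- From `log t ≤ t - 1`. One factor `2` bounds `1 / log 2`; the other replaces `radius y` by `radius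
-- x`, as `radius x ≤ radius y + 1 ≤ 2 * radius y`.
variable {P} in
theorem abs_logb_radius_sub_le {x y : V} (h : P.graph.Adj x y) :
    |Real.logb 2 (P.radius x) - Real.logb 2 (P.radius y)| ≤ 4 / P.radius x := by
  have key : ∀ {a b : ℝ}, 0 < a → 0 < b → b - a ≤ 1 →
      Real.logb 2 b - Real.logb 2 a ≤ 2 / a := by
    intro a b ha hb hab
    have hlog2 : 1 / 2 ≤ Real.log 2 := by linarith [Real.log_two_gt_d9]
    rw [← Real.logb_div hb.ne' ha.ne', Real.logb]
    have h1 : Real.log (b / a) ≤ 1 / a := by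
      refine (Real.log_le_sub_one_of_pos (by positivity)).trans ?_
      rw [div_sub_one ha.ne']
      gcongr
    rw [div_le_iff₀ (by linarith)]
    calc Real.log (b / a) ≤ 1 / a := h1
      _ = 2 / a * (1 / 2) := by ring
      _ ≤ 2 / a * Real.log 2 := by gcongr
  have hx := P.one_le_radius x
  have hy := P.one_le_radius y
  have hxy := abs_le.1 (abs_radius_sub_le h)
  rw [abs_sub_le_iff]
  constructor
  · refine (key (P.radius_pos y) (P.radius_pos x) (by linarith)).trans ?_
    rw [div_le_div_iff₀ (by linarith) (by linarith)]
    linarith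
  · refine (key (P.radius_pos x) (P.radius_pos y) (by linarith)).trans ?_
    gcongr
    norm_num

-- Truncation at `0` is 1-Lipschitz, so the logarithmic estimate passes to the cutoff.
variable {P} in
theorem cutoff_sub_sq_le {n : ℕ} {x y : V} (h : P.graph.Adj x y) :
    (P.cutoff n x - P.cutoff n y) ^ 2 ≤ 16 / n ^ 2 * (P.radius x ^ 2)⁻¹ := by
  have h1 : |P.cutoff n x - P.cutoff n y| ≤ 4 / P.radius x / n := by
    unfold cutoff
    rw [max_comm 0, max_comm 0]
    refine (abs_max_sub_max_le_abs _ _ _).trans ?_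
    rw [sub_sub_sub_cancel_left, ← sub_div, abs_div, abs_sub_comm, Nat.abs_cast]
    gcongr
    exact abs_logb_radius_sub_le h
  calc (P.cutoff n x - P.cutoff n y) ^ 2 = |P.cutoff n x - P.cutoff n y| ^ 2 := (sq_abs _).symm
    _ ≤ (4 / P.radius x / n) ^ 2 := by gcongr
    _ = _ := by
      rw [div_pow, div_pow]
      ring

/-- The constant is `9 * 16 * 16 * 2`: degree, squared gradient, annulus sum, and `n + 1 ≤ 2 * n`.
-/
theorem dirichletEnergy_cutoff_le {n : ℕ} (hn : n ≠ 0) (T : Finset V) :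
    P.graph.dirichletEnergy T (P.cutoff n) ≤ 4608 / n := by
  classical
  have hn1 : (1 : ℝ) ≤ n := by exact_mod_cast Nat.one_le_iff_ne_zero.2 hn
  -- Beyond radius `2 ^ (n + 1)` all neighbors have radius at least `2 ^ (n + 1) - 1 ≥ 2 ^ n`, so
  -- the row vanishes.
  have hrow : ∀ x, ∑ y ∈ T, (if P.graph.Adj x y then (P.cutoff n x - P.cutoff n y) ^ 2 else 0) ≤
      if P.radius x < 2 ^ (n + 1) then 144 / n ^ 2 * (P.radius x ^ 2)⁻¹ else 0 := by
    intro x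
    rw [← Finset.sum_filter]
    have hsub : T.filter (P.graph.Adj x) ⊆ P.graph.neighborFinset x := fun y hy => by
      simpa using (Finset.mem_filter.1 hy).2
    split_ifs with hx
    · have hnn : 0 ≤ 16 / (n : ℝ) ^ 2 * (P.radius x ^ 2)⁻¹ := by positivity
      calc _ ≤ ∑ _y ∈ T.filter (P.graph.Adj x), 16 / (n : ℝ) ^ 2 * (P.radius x ^ 2)⁻¹ :=
            Finset.sum_le_sum fun y hy => cutoff_sub_sq_le (Finset.mem_filter.1 hy).2
        _ = (T.filter (P.graph.Adj x)).card * (16 / (n : ℝ) ^ 2 * (P.radius x ^ 2)⁻¹) := by simp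
        _ ≤ 9 * (16 / (n : ℝ) ^ 2 * (P.radius x ^ 2)⁻¹) := by
            refine mul_le_mul_of_nonneg_right ?_ hnn
            exact le_trans (by exact_mod_cast Finset.card_le_card hsub)
              (P.card_neighborFinset_le x)
        _ = _ := by ring
    · refine (Finset.sum_eq_zero fun y hy => ?_).le
      have hxy := abs_le.1 (abs_radius_sub_le (Finset.mem_filter.1 hy).2)
      have hpow : (1 : ℝ) ≤ 2 ^ n := one_le_pow₀ one_le_two
      rw [pow_succ] at hx
      have hx0 : P.cutoff n x = 0 := by
        by_contra hne
        linarith [P.radius_lt_of_cutoff_ne_zero hn hne]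
      have hy0 : P.cutoff n y = 0 := by
        by_contra hne
        linarith [P.radius_lt_of_cutoff_ne_zero hn hne]
      simp [hx0, hy0]
  have hsum : ∑ x ∈ T.filter (fun x => P.radius x < 2 ^ (n + 1)), (P.radius x ^ 2)⁻¹ ≤
      16 * ((n + 1 : ℕ) : ℝ) :=
    P.sum_inv_radius_sq_le fun x hx => (Finset.mem_filter.1 hx).2
  calc P.graph.dirichletEnergy T (P.cutoff n)
      ≤ ∑ x ∈ T, if P.radius x < 2 ^ (n + 1) then 144 / (n : ℝ) ^ 2 * (P.radius x ^ 2)⁻¹ else 0 := by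
        unfold SimpleGraph.dirichletEnergy
        exact Finset.sum_le_sum fun x _ => by convert hrow x
    _ = 144 / (n : ℝ) ^ 2 *
        ∑ x ∈ T.filter (fun x => P.radius x < 2 ^ (n + 1)), (P.radius x ^ 2)⁻¹ := by
        rw [← Finset.sum_filter, Finset.mul_sum]
    _ ≤ 144 / (n : ℝ) ^ 2 * (16 * ((n + 1 : ℕ) : ℝ)) := by gcongr
    _ ≤ 144 / (n : ℝ) ^ 2 * (16 * (2 * n)) := by
        gcongr
        push_cast
        linarith
    _ = 4608 / n := by
        field_simp
        norm_num

/-- Positive superharmonic functions on a connected penny graph are constant: the graph has at most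
quadratic growth with respect to the Euclidean distance. No bound on facial degrees is needed. -/
theorem superharmonic_const (hconn : P.graph.Connected) {f : V → ℝ} (hpos : ∀ x, 0 < f x)
    (hf : P.graph.IsSuperharmonic f) (x y : V) : f x = f y :=
  -- The shift skips `n = 0`, where division by zero makes the cutoff identically `1`.
  hf.eq_of_tendsto_energy hconn (φ := fun n => P.cutoff (n + 1))
    (fun n => P.finite_support_cutoff n.succ_ne_zero)
    (fun x => (P.tendsto_cutoff x).comp (tendsto_add_atTop_nat 1))
    (B := fun n => 4608 / ((n + 1 : ℕ) : ℝ))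
    ((tendsto_const_nhds.div_atTop tendsto_natCast_atTop_atTop).comp (tendsto_add_atTop_nat 1))
    (fun n T => P.dirichletEnergy_cutoff_le n.succ_ne_zero T) hpos x y

end PennyConfiguration

namespace SimpleGraph

/-! ### Avoidance probabilities and recurrence -/

section Recurrence

open MeasureTheory ProbabilityTheory Preorder
open scoped ENNReal

variable {V : Type*} (G : SimpleGraph V) [G.LocallyFinite]

open Classical in
/-- The indicator of the trajectories up to time `n` that avoid `o` at the times `1, …, n`. -/
noncomputable def avoidIndicator (o : V) (n : ℕ) (p : Π _ : Finset.Iic n, V) : ℝ≥0∞ :=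
  if ∀ i : Finset.Iic n, 1 ≤ i.1 → p i ≠ o then 1 else 0

open Classical in
theorem avoidIndicator_succ (o : V) (n : ℕ) (ω : ℕ → V) :
    avoidIndicator o (n + 1) (frestrictLe (π := fun _ => V) (n + 1) ω) =
      avoidIndicator o n (frestrictLe (π := fun _ => V) n ω) *
        if ω (n + 1) = o then 0 else 1 := by
  have key : (∀ i : Finset.Iic (n + 1), 1 ≤ i.1 → ω i ≠ o) ↔
      (∀ i : Finset.Iic n, 1 ≤ i.1 → ω i ≠ o) ∧ ω (n + 1) ≠ o := by
    simp only [Subtype.forall, Finset.mem_Iic]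
    refine ⟨fun h => ⟨fun i hi => h i (by omega), h _ le_rfl (by omega)⟩, ?_⟩
    rintro ⟨h1, h2⟩ i hi hi1
    rcases Nat.le_succ_iff.1 hi with h | rfl
    exacts [h1 i h hi1, h2]
  simp only [avoidIndicator, frestrictLe_apply, key]
  split_ifs <;> simp_all

section Law

variable [MeasurableSpace V]

open Classical in
/-- The probability that the walk from a given vertex avoids `o` at the times `1, …, m`. -/
noncomputable def avoidProb (o : V) : ℕ → V → ℝ≥0∞
  | 0, _ => 1
  | m + 1, x => ∫⁻ z, (if z = o then 0 else avoidProb o m z) ∂(G.walkStep x).toMeasure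

theorem avoidProb_le_one (o : V) (m : ℕ) (x : V) : G.avoidProb o m x ≤ 1 := by
  induction m generalizing x with
  | zero => exact le_rfl
  | succ m ih =>
    have := PMF.toMeasure.isProbabilityMeasure (G.walkStep x)
    calc G.avoidProb o (m + 1) x ≤ ∫⁻ _, 1 ∂(G.walkStep x).toMeasure := by
          refine lintegral_mono fun z => ?_
          dsimp only
          split_ifs
          exacts [zero_le_one, ih z]
      _ = 1 := by simp

theorem avoidProb_antitone (o x : V) : Antitone fun m => G.avoidProb o m x := by
  refine antitone_nat_of_succ_le fun m => ?_
  induction m generalizing x with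
  | zero => exact G.avoidProb_le_one o 1 x
  | succ m ih =>
    refine lintegral_mono fun z => ?_
    dsimp only
    split_ifs
    exacts [le_rfl, ih z]

variable [DiscreteMeasurableSpace V]

/-- The Markov property of the simple random walk, for one step. -/
theorem lintegral_walkLaw_succ (x : V) (n : ℕ) {F : (Π _ : Finset.Iic n, V) → ℝ≥0∞}
    (hF : Measurable F) (g : V → ℝ≥0∞) :
    ∫⁻ ω, F (frestrictLe n ω) * g (ω (n + 1)) ∂G.walkLaw x =
      ∫⁻ ω, F (frestrictLe n ω) * ∫⁻ z, g z ∂(G.walkStep (ω n)).toMeasure ∂G.walkLaw x := by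
  have hg : Measurable g := .of_discrete
  have hstep : Measurable fun y => ∫⁻ z, g z ∂(G.walkStep y).toMeasure := .of_discrete
  set κ : (n : ℕ) → Kernel (Π _ : Finset.Iic n, V) V := fun n => G.walkKernel n
  set x₀ : Π _ : Finset.Iic 0, V := fun _ => x
  set μ : Measure (Π _ : Finset.Iic n, V) :=
    Kernel.partialTraj (X := fun _ => V) κ 0 n x₀
  set τ : Kernel (Π _ : Finset.Iic n, V) (ℕ → V) := Kernel.traj (X := fun _ => V) κ n
  -- Disintegrate the walk into its past up to time `n` and the continuation kernel, whose next
  -- coordinate has law `κ n`.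
  have hmap : μ ⊗ₘ τ = (G.walkLaw x).map fun ω => (frestrictLe n ω, ω) :=
    Kernel.partialTraj_compProd_traj (X := fun _ => V) (κ := κ) (zero_le (a := n)) x₀
  have hmap' : (G.walkLaw x).map (frestrictLe n) = μ :=
    Kernel.traj_map_frestrictLe_apply (X := fun _ => V) (κ := κ) 0 n x₀
  have hsucc : τ.map (fun ω => ω (n + 1)) = κ n :=
    Kernel.map_traj_succ_self (X := fun _ => V) (κ := κ)
  have hmeas : Measurable fun p : (Π _ : Finset.Iic n, V) × (ℕ → V) => F p.1 * g (p.2 (n + 1)) := by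
    fun_prop
  have hpast : Measurable fun p : Π _ : Finset.Iic n, V =>
      F p * ∫⁻ z, g z ∂(G.walkStep (p ⟨n, Finset.mem_Iic.2 le_rfl⟩)).toMeasure :=
    hF.mul (hstep.comp (measurable_pi_apply _))
  calc ∫⁻ ω, F (frestrictLe n ω) * g (ω (n + 1)) ∂G.walkLaw x
      = ∫⁻ p, F p.1 * g (p.2 (n + 1)) ∂(μ ⊗ₘ τ) := by
        rw [hmap, lintegral_map hmeas (by fun_prop)]
    _ = ∫⁻ p, F p * ∫⁻ z, g z ∂(G.walkStep (p ⟨n, Finset.mem_Iic.2 le_rfl⟩)).toMeasure ∂μ := by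
        rw [Measure.lintegral_compProd hmeas]
        refine lintegral_congr fun p => ?_
        dsimp only
        rw [lintegral_const_mul _ (by fun_prop)]
        congr 1
        have h1 : κ n p = (τ p).map (fun ω => ω (n + 1)) := by
          rw [← Kernel.map_apply _ (by fun_prop), hsucc]
        change _ = ∫⁻ z, g z ∂κ n p
        rw [h1, lintegral_map hg (by fun_prop)]
    _ = _ := by
        rw [← hmap', lintegral_map hpast (measurable_frestrictLe _)]
        rfl

theorem walkStep_toMeasure_lintegral {x : V} (hx : (G.neighborFinset x).Nonempty)
    (g : V → ℝ≥0∞) :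
    ∫⁻ z, g z ∂(G.walkStep x).toMeasure =
      (∑ z ∈ G.neighborFinset x, g z) * (((G.neighborFinset x).card : ℝ≥0∞))⁻¹ := by
  rw [walkStep, dif_pos hx, ← PMF.restrict_toMeasure_support, PMF.support_uniformOfFinset,
    lintegral_finset, Finset.sum_mul]
  refine Finset.sum_congr rfl fun z hz => ?_
  rw [PMF.toMeasure_apply_singleton _ _ (measurableSet_singleton z),
    PMF.uniformOfFinset_apply_of_mem hx hz]

theorem measurable_avoidIndicator (o : V) (n : ℕ) : Measurable (avoidIndicator o n) := by
  refine Measurable.ite ?_ measurable_const measurable_const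
  simp only [Set.ofPred_forall]
  refine MeasurableSet.iInter fun i => MeasurableSet.iInter fun _ => ?_
  exact measurableSet_preimage (measurable_pi_apply (X := fun _ => V) i)
    (MeasurableSet.of_discrete (s := {z : V | z ≠ o}))

/-- Ties the recursive `avoidProb` to the walk: each use of the Markov property trades one step of
the recursion for one more avoided time. -/
theorem lintegral_avoidIndicator_mul_avoidProb (o x : V) (m n : ℕ) :
    ∫⁻ ω, avoidIndicator o n (frestrictLe (π := fun _ => V) n ω) * G.avoidProb o m (ω n)
        ∂G.walkLaw x =
      ∫⁻ ω, avoidIndicator o (n + m) (frestrictLe (π := fun _ => V) (n + m) ω) ∂G.walkLaw x := by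
  classical
  induction m generalizing n with
  | zero => simp [avoidProb]
  | succ m ih =>
    have := G.lintegral_walkLaw_succ x n (measurable_avoidIndicator o n)
      (fun z => if z = o then 0 else G.avoidProb o m z)
    rw [show n + (m + 1) = n + 1 + m by ring, ← ih]
    simp only [avoidProb]
    rw [← this]
    refine lintegral_congr fun ω => ?_
    rw [avoidIndicator_succ, mul_assoc]
    congr 1
    split_ifs <;> simp

theorem measurable_avoidIndicator_frestrictLe (o : V) (n : ℕ) :
    Measurable fun ω : ℕ → V => avoidIndicator o n (frestrictLe (π := fun _ => V) n ω) :=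
  (measurable_avoidIndicator o n).comp (measurable_frestrictLe n)

/-- If the avoidance probabilities tend to zero, then `o` is visited almost surely. -/
theorem ae_exists_eq_of_iInf_avoidProb_eq_zero (o x : V)
    (h : ∀ y, ⨅ m, G.avoidProb o m y = 0) : ∀ᵐ ω ∂G.walkLaw x, ∃ n : ℕ, 1 ≤ n ∧ ω n = o := by
  have : IsProbabilityMeasure (G.walkLaw x) := by unfold walkLaw; infer_instance
  -- The starting point is kept as `ω 0` and never identified with `x`, which is why `h` ranges over
  -- all vertices.
  have hmeas : ∀ m, Measurable fun ω : ℕ → V => G.avoidProb o m (ω 0) := fun m =>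
    (Measurable.of_discrete (f := G.avoidProb o m)).comp (measurable_pi_apply 0)
  have h0 : ⨅ m, ∫⁻ ω, G.avoidProb o m (ω 0) ∂G.walkLaw x = 0 := by
    rw [← lintegral_iInf hmeas (fun _ _ hij ω => G.avoidProb_antitone o (ω 0) hij)]
    · simp [h]
    · simp [avoidProb]
  have hle : ∀ m, ∫⁻ ω, (⨅ n, avoidIndicator o n (frestrictLe (π := fun _ => V) n ω))
      ∂G.walkLaw x ≤ ∫⁻ ω, G.avoidProb o m (ω 0) ∂G.walkLaw x := by
    intro m
    calc _
        ≤ ∫⁻ ω, avoidIndicator o (0 + m) (frestrictLe (π := fun _ => V) (0 + m) ω)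
            ∂G.walkLaw x := lintegral_mono fun ω => iInf_le
              (fun n => avoidIndicator o n (frestrictLe (π := fun _ => V) n ω)) (0 + m)
      _ = _ := (G.lintegral_avoidIndicator_mul_avoidProb o x m 0).symm
      _ ≤ _ := lintegral_mono fun ω => mul_le_of_le_one_left zero_le (by
          unfold avoidIndicator
          split_ifs
          exacts [le_rfl, zero_le_one])
  have hzero := le_antisymm ((le_iInf hle).trans h0.le) zero_le
  rw [lintegral_eq_zero_iff (.iInf fun n => measurable_avoidIndicator_frestrictLe o n)] at hzero
  filter_upwards [hzero] with ω hω
  by_contra! hne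
  have hone : ∀ n, avoidIndicator o n (frestrictLe (π := fun _ => V) n ω) = 1 := fun n =>
    if_pos (c := ∀ i : Finset.Iic n, 1 ≤ i.1 → ω i ≠ o) fun i hi => hne i hi
  simp [hone] at hω

-- First-step equation for the probability of never visiting `o`, by decreasing monotone convergence
-- in the recursion.
open Classical in
theorem iInf_avoidProb_eq (o x : V) : ⨅ m, G.avoidProb o m x =
    ∫⁻ z, (if z = o then 0 else ⨅ m, G.avoidProb o m z) ∂(G.walkStep x).toMeasure := by
  have := PMF.toMeasure.isProbabilityMeasure (G.walkStep x)
  have h1 : ⨅ m, G.avoidProb o m x = ⨅ m, G.avoidProb o (m + 1) x :=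
    ((G.avoidProb_antitone o x).iInf_nat_add 1).symm
  simp only [h1, avoidProb]
  rw [← lintegral_iInf (fun _ => .of_discrete)]
  · refine lintegral_congr fun z => ?_
    split_ifs <;> simp
  · intro i j hij z
    dsimp only
    split_ifs
    exacts [le_rfl, G.avoidProb_antitone o z hij]
  · refine ((lintegral_mono fun z => ?_).trans_lt
      (show ∫⁻ _, 1 ∂(G.walkStep x).toMeasure < ∞ by simp)).ne
    dsimp only
    split_ifs
    exacts [zero_le_one, G.avoidProb_le_one o 0 z]

end Law

/-- If all positive superharmonic functions are constant, then the walk is recurrent. -/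
theorem isRecurrent_of_superharmonic_const (hne : ∀ x, (G.neighborFinset x).Nonempty)
    (hconst : ∀ f : V → ℝ, (∀ x, 0 < f x) → G.IsSuperharmonic f → ∀ x y, f x = f y) :
    G.IsRecurrent := by
  classical
  let _ : MeasurableSpace V := ⊤
  have _ : DiscreteMeasurableSpace V := ⟨fun _ => trivial⟩
  intro o
  refine G.ae_exists_eq_of_iInf_avoidProb_eq_zero o o ?_
  set q : V → ℝ≥0∞ := fun x => ⨅ m, G.avoidProb o m x with hq
  set q' : V → ℝ≥0∞ := fun x => if x = o then 0 else q x with hq'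
  have hq1 : ∀ x, q x ≤ 1 := fun x => (iInf_le _ 0).trans (G.avoidProb_le_one o 0 x)
  have hqq : ∀ x, q' x ≤ q x := fun x => by
    simp only [hq']
    split_ifs
    exacts [zero_le, le_rfl]
  have htop : ∀ x, q x ≠ ∞ := fun x => ((hq1 x).trans_lt ENNReal.one_lt_top).ne
  have htop' : ∀ x, q' x ≠ ∞ := fun x => ((hqq x).trans_lt (htop x).lt_top).ne
  have hmean : ∀ x, (G.neighborFinset x).card * (q x).toReal =
      ∑ z ∈ G.neighborFinset x, (q' z).toReal := by
    intro x
    have h1 : q x = (∑ z ∈ G.neighborFinset x, q' z) * ((G.neighborFinset x).card : ℝ≥0∞)⁻¹ :=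
      (G.iInf_avoidProb_eq o x).trans (G.walkStep_toMeasure_lintegral (hne x) q')
    have hcard : ((G.neighborFinset x).card : ℝ) ≠ 0 := by
      exact_mod_cast (Finset.card_pos.2 (hne x)).ne'
    rw [h1, ENNReal.toReal_mul, ENNReal.toReal_sum fun z _ => htop' z]
    simp only [ENNReal.toReal_inv, ENNReal.toReal_natCast]
    field_simp
  have hq'o : q' o = 0 := if_pos rfl
  have hzero : ∀ x, q' x = 0 := by
    intro x
    -- Since `q' ≤ 1`, subtracting from `2` gives strict positivity. Superharmonicity holds at `o`
    -- too: `q' ≤ q` everywhere, and `q` is the neighbor average of `q'`.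
    have hc := hconst (fun x => 2 - (q' x).toReal) (fun x => ?_) (fun x => ?_) x o
    · simp only [hq'o, ENNReal.toReal_zero, sub_right_inj] at hc
      exact ((ENNReal.toReal_eq_zero_iff _).1 hc).resolve_right (htop' x)
    · have : (q' x).toReal ≤ 1 := by
        simpa using ENNReal.toReal_mono ENNReal.one_ne_top ((hqq x).trans (hq1 x))
      linarith
    · have h1 := hmean x
      have h2 : (q' x).toReal ≤ (q x).toReal := ENNReal.toReal_mono (htop x) (hqq x)
      have h3 := mul_le_mul_of_nonneg_left h2 (Nat.cast_nonneg (α := ℝ) (G.neighborFinset x).card)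
      simp only [combLaplacian, sub_sub_sub_cancel_left, Finset.sum_sub_distrib, Finset.sum_const,
        nsmul_eq_mul]
      linarith
  -- Averaging `q' = 0` over neighbors gives `q = 0` also at `o`, where `q'` carried no information.
  intro y
  have h1 := hmean y
  simp only [hzero, ENNReal.toReal_zero, Finset.sum_const_zero, mul_eq_zero, Nat.cast_eq_zero,
    (Finset.card_pos.2 (hne y)).ne', false_or] at h1
  exact ((ENNReal.toReal_eq_zero_iff _).1 h1).resolve_right (htop y)

end Recurrence

end SimpleGraph

theorem mainTheorem5 {V : Type*} [Infinite V] (P : PennyConfiguration V)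
    (hconn : P.graph.Connected) (hdeg : P.HasBoundedFacialDegree) :
    P.graph.IsRecurrent ∧
      ∀ f : V → ℝ, (∀ x, 0 < f x) → P.graph.IsSuperharmonic f → ∃ c : ℝ, ∀ x, f x = c := by
  refine ⟨P.graph.isRecurrent_of_superharmonic_const (fun x => ?_)
    fun f hpos hf => P.superharmonic_const hconn hpos hf, fun f hpos hf => ?_⟩
  -- Infinitely many vertices and connectedness exclude isolated ones, so the walk never stays put.
  · obtain ⟨y, hy⟩ := hconn.preconnected.exists_adj_of_nontrivial x
    exact ⟨y, (P.graph.mem_neighborFinset x y).2 hy⟩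
  · obtain ⟨x₀⟩ := hconn.nonempty
    exact ⟨f x₀, fun x => P.superharmonic_const hconn hpos hf x x₀⟩
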